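/- Let $d\ge 2$ be an integer. Consider the Bell scenario in which Alice receives a pair $x=(x_1,x_2)$ with $1\le x_1<x_2\le d^2$ and outputs $a\in\{1,2,\perp\}$, while Bob receives $y\in\{1,\dots,d^2\}$ and outputs $b\in\{1,\perp\}$. A quantum realisation consists of complex Hilbert spaces $H_A,H_B$ of arbitrary dimension, a density operator $\rho$ on the Hilbert space tensor product $H_A\otimes H_B$, measurements (POVMs) $\{A_x^a\}_a$ on $H_A$ for each $x$ and $\{B_y^b\}_b$ on $H_B$ for each $y$; it yields $p(a,b|x,y)=\operatorname{Tr}[\rho\,(A_x^a\otimes B_y^b)]$ with marginals $p(a|x)$, $p(b|y)$. Put $B_y=B_y^1$. Define $$\mathcal R_d=\sum_{x_1<x_2}\big(p(1,1|x,x_1)-p(1,1|x,x_2)+p(2,1|x,x_2)-p(2,1|x,x_1)\big),$$ $$\mathcal S_d^{\mathrm{SIC}}=\mathcal R_d-\alpha_d\sum_{x_1<x_2}\big(p(a{=}1|x)+p(a{=}2|x)\big)-\beta_d\sum_{y}p(b{=}1|y),$$ where $\alpha_d=\frac{1-\delta_{d,2}}{2}\sqrt{\frac{d}{d+1}}$ and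 $\beta_d=\frac{d-2}{2}\sqrt{d(d+1)}$, and let $Q_d=\frac{d+2\delta_{d,2}}{2}\sqrt{d(d+1)}$. (1) $Q_d$ is the maximal quantum value: every quantum realisation satisfies $\mathcal S_d^{\mathrm{SIC}}\le Q_d$, and if a SIC exists in dimension $d$ (unit vectors $r_1,\dots,r_{d^2}\in\mathbb C^d$ with $|\langle r_j|r_k\rangle|^2=\frac1{d+1}$ for all $j\ne k$), then equality is attained by a realisation on $\mathbb C^d\otimes\mathbb C^d$ for which Bob's marginal state has full rank. (2) If a quantum realisation reaches $\mathcal S_d^{\mathrm{SIC}}=Q_d$ and Bob's marginal state $\rho_B=\operatorname{Tr}_A\rho$ has full rank (trivial kernel), then all $B_y$ are (orthogonal) projectors, $\sum_{y}B_y=d\,\mathbb 1$, and $B_y=(d+1)B_yB_{y'}B_y$ for all $y\neq y'$; moreover, they form an operational SIC, i.e. they are projectors with $\sum_y B_y=d\,\mathbb 1$ such that for every unit vector $\psi\in H_B$ and all $y\ne y'$, $\langle\psi|B_y|\psi\rangle=1$ implies $\langle\psi|B_{y'}|\psi\rangle=\frac1{d+1}$. (3) For any family of bounded operators $B_1,\dots,B_{d^2}$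 on a complex Hilbert space, being projectors with $\sum_yB_y=d\,\mathbb 1$ and $B_y=(d+1)B_yB_{y'}B_y$ for all $y\ne y'$ is equivalent to being an operational SIC. -/

import Mathlib

universe u v

noncomputable section

namespace SICBell

open UniformSpace TensorProduct
open scoped InnerProductSpace

/-- The Hilbert space tensor product of `HA` and `HB`: the completion of the algebraic tensor
product for the inner product `⟪a ⊗ b, a' ⊗ b'⟫ = ⟪a, a'⟫ ⟪b, b'⟫`. -/
abbrev JointSpace (HA HB : Type*) [NormedAddCommGroup HA] [InnerProductSpace ℂ HA]
    [NormedAddCommGroup HB] [InnerProductSpace ℂ HB] : Type _ :=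
  Completion (HA ⊗[ℂ] HB)

/-- The bounded operator `S ⊗ T` on the Hilbert space tensor product. -/
def opTensor {HA HB : Type*} [NormedAddCommGroup HA] [InnerProductSpace ℂ HA]
    [NormedAddCommGroup HB] [InnerProductSpace ℂ HB] (S : HA →L[ℂ] HA) (T : HB →L[ℂ] HB) :
    JointSpace HA HB →L[ℂ] JointSpace HA HB :=
  (TensorProduct.mapL S T).completion

/-- A measurement (POVM) with outcomes in `ι`: positive operators that sum to the identity. -/
structure Measurement (ι : Type*) [Fintype ι] (H : Type*) [NormedAddCommGroup H]
    [InnerProductSpace ℂ H] where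
  effect : ι → H →L[ℂ] H
  isPositive : ∀ i, (effect i).IsPositive
  sum_effect : ∑ i, effect i = 1

/-- Pairs `x = (x₁, x₂)` with `x₁ < x₂`. -/
abbrev Pairs (n : ℕ) : Type := {x : Fin n × Fin n // x.1 < x.2}

/-- A quantum realisation of the Bell scenario with parameter `d`.

The shared state is the density operator `ρ = ∑ i, |ψ i⟩⟨ψ i|` on the Hilbert space tensor product,
with `∑ i, ‖ψ i‖ ^ 2 = 1`. Every density operator has this form (spectral decomposition), and pure
states are those with a single non-zero `ψ i`.

Alice has an input `x` in `Pairs (d ^ 2)` and three outcomes, `0, 1, 2` standing for `1, 2, ⊥`.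
Bob has an input `y` in `Fin (d ^ 2)` and two outcomes, `0, 1` standing for `1, ⊥`. -/
structure Realisation (d : ℕ) (HA HB : Type*) [NormedAddCommGroup HA] [InnerProductSpace ℂ HA]
    [NormedAddCommGroup HB] [InnerProductSpace ℂ HB] where
  ψ : ℕ → JointSpace HA HB
  hasSum_norm_sq : HasSum (fun i => ‖ψ i‖ ^ 2) 1
  alice : Pairs (d ^ 2) → Measurement (Fin 3) HA
  bob : Fin (d ^ 2) → Measurement (Fin 2) HB

namespace Realisation

variable {d : ℕ} {HA HB : Type*} [NormedAddCommGroup HA] [InnerProductSpace ℂ HA]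
  [NormedAddCommGroup HB] [InnerProductSpace ℂ HB]

/-- The expectation value `Tr (ρ T)` (real part; the trace is real for self-adjoint `T`). The series
always converges absolutely, as `‖T‖ * ‖ψ i‖ ^ 2` is summable. -/
def expect (R : Realisation d HA HB) (T : JointSpace HA HB →L[ℂ] JointSpace HA HB) : ℝ :=
  ∑' i, (⟪R.ψ i, T (R.ψ i)⟫_ℂ).re

/-- The joint probability `p(a, b | x, y)`. -/
def prob (R : Realisation d HA HB) (a : Fin 3) (b : Fin 2) (x : Pairs (d ^ 2))
    (y : Fin (d ^ 2)) : ℝ :=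
  R.expect (opTensor ((R.alice x).effect a) ((R.bob y).effect b))

/-- Alice's marginal probability `p(a | x)`. -/
def probA (R : Realisation d HA HB) (a : Fin 3) (x : Pairs (d ^ 2)) : ℝ :=
  R.expect (opTensor ((R.alice x).effect a) 1)

/-- Bob's marginal probability `p(b | y)`. -/
def probB (R : Realisation d HA HB) (b : Fin 2) (y : Fin (d ^ 2)) : ℝ :=
  R.expect (opTensor 1 ((R.bob y).effect b))

/-- Bob's outcome-one operators. -/
def B (R : Realisation d HA HB) (y : Fin (d ^ 2)) : HB →L[ℂ] HB :=
  (R.bob y).effect 0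

/-- The quadratic form `⟨φ| ρ_B |φ⟩ = Tr (ρ (1 ⊗ |φ⟩⟨φ|))` of Bob's marginal state
`ρ_B = Tr_A ρ`. -/
def bobMarginal (R : Realisation d HA HB) (φ : HB) : ℝ :=
  R.expect (opTensor 1 (InnerProductSpace.rankOne ℂ φ φ))

/-- Bob's marginal state has full rank: `⟨φ| ρ_B |φ⟩ > 0` for all `φ ≠ 0`; as `ρ_B` is a positive
operator, this says that its kernel is trivial. -/
def BobFullRank (R : Realisation d HA HB) : Prop :=
  ∀ φ : HB, φ ≠ 0 → 0 < R.bobMarginal φ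

end Realisation

/-- The penalty for Alice. -/
def α (d : ℕ) : ℝ := (1 - if d = 2 then 1 else 0) / 2 * √((d : ℝ) / (d + 1))

/-- The penalty for Bob. -/
def β (d : ℕ) : ℝ := ((d : ℝ) - 2) / 2 * √((d : ℝ) * (d + 1))

/-- The maximal quantum value. -/
def quantumValue (d : ℕ) : ℝ :=
  ((d : ℝ) + 2 * if d = 2 then 1 else 0) / 2 * √((d : ℝ) * (d + 1))

namespace Realisation

variable {d : ℕ} {HA HB : Type*} [NormedAddCommGroup HA] [InnerProductSpace ℂ HA]
  [NormedAddCommGroup HB] [InnerProductSpace ℂ HB]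

/-- The score before penalties. -/
def scoreR (R : Realisation d HA HB) : ℝ :=
  ∑ x : Pairs (d ^ 2),
    (R.prob 0 0 x x.1.1 - R.prob 0 0 x x.1.2 + R.prob 1 0 x x.1.2 - R.prob 1 0 x x.1.1)

/-- The Bell functional for SICs. -/
def scoreS (R : Realisation d HA HB) : ℝ :=
  R.scoreR - α d * ∑ x : Pairs (d ^ 2), (R.probA 0 x + R.probA 1 x)
    - β d * ∑ y : Fin (d ^ 2), R.probB 0 y

end Realisation

/-- A SIC in dimension `d`, given by unit vectors. -/
structure IsSIC {d : ℕ} (r : Fin (d ^ 2) → EuclideanSpace ℂ (Fin d)) : Prop where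
  norm_eq : ∀ j, ‖r j‖ = 1
  overlap : ∀ j k, j ≠ k → ‖⟪r j, r k⟫_ℂ‖ ^ 2 = 1 / ((d : ℝ) + 1)

/-- An operational SIC: orthogonal projections `B a` that sum to `n` times the identity, such that
every unit vector `φ` with `⟨φ|B a|φ⟩ = 1` has `⟨φ|B b|φ⟩ = 1 / (n + 1)` for all `b ≠ a`. -/
structure IsOperationalSIC {H : Type*} [NormedAddCommGroup H] [InnerProductSpace ℂ H]
    [CompleteSpace H] (n : ℕ) (B : Fin (n ^ 2) → H →L[ℂ] H) : Prop where
  isStarProjection : ∀ a, IsStarProjection (B a)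
  sum_eq : ∑ a, B a = (n : ℂ) • (1 : H →L[ℂ] H)
  unbiased : ∀ a b, a ≠ b → ∀ φ : H, ‖φ‖ = 1 → ⟪φ, B a φ⟫_ℂ = 1 →
    ⟪φ, B b φ⟫_ℂ = 1 / ((n : ℂ) + 1)

/-- The algebraic relations: projections with `∑ B y = d` and `B y = (d + 1) B y B y' B y`. -/
structure SICRelations {H : Type*} [NormedAddCommGroup H] [InnerProductSpace ℂ H]
    [CompleteSpace H] (d : ℕ) (B : Fin (d ^ 2) → H →L[ℂ] H) : Prop where
  isStarProjection : ∀ y, IsStarProjection (B y)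
  sum_eq : ∑ y, B y = (d : ℂ) • (1 : H →L[ℂ] H)
  sandwich : ∀ y y', y ≠ y' → B y = ((d : ℂ) + 1) • (B y * B y' * B y)

end SICBell

end

/-!
The upper bound comes from a sum of squares. Write `g = √(d / (d + 1))` (`gap d`), `K = ∑ y, B y` and
`D x = B x₁ - B x₂`. Alice's term for the input `x` is `A⁰ ⊗ (D - α) + A¹ ⊗ (-D - α)`, and
`(D ∓ g)² ≥ 0` bounds both operators `±D - α` by `D² / (2 g) + ε` where `ε = g / 2 - α`
(`shortfall d`, zero unless `d = 2`). Alice's effects sum to one, and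
`∑ x, D x ^ 2 = d² ∑ y, B y ^ 2 - K²`. Bob's penalty is `d (d - 2) / (2 g)` per input, so with
`B y ^ 2 ≤ B y` the total is at most `(2 d K - K²) / (2 g) + ε * #pairs`, and completing the square
bounds it by `d² / (2 g) + ε * #pairs`, which is the quantum value. The exact form is
`Realisation.quantumValue_sub_scoreS`.

At equality every term vanishes. Bob's marginal state is faithful
(`BobFullRank.eq_zero_of_corr_eq_zero`), so `B y ^ 2 = B y` and `K = d`. The terms with Alice's three
effects say that `D - g`, `D + g` and `D` vanish against the respective effect; each is a factor of
`D³ - g² D`, and since the effects sum to one, `D³ = g² D` (`Realisation.diff_cubed`). For two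
projections `p`, `q` this forces `E = p q p - p / (d + 1)` to satisfy `E² = g² E`, so `E ≥ 0`. For
fixed `p` the sum of these operators over all `q ≠ p` is zero because `K = d`; hence `E = 0`
(`sandwich_eq`).

The value is attained on the maximally entangled state, with Bob measuring the projections of the SIC
and Alice the transposed spectral projections of `D x` for the eigenvalues `g`, `-g` and `0`.
-/

namespace SICBell

open UniformSpace TensorProduct
open scoped InnerProductSpace

/-! ### Operators on the Hilbert space tensor product -/

section Operators

variable {HA HB : Type*} [NormedAddCommGroup HA] [InnerProductSpace ℂ HA]
  [NormedAddCommGroup HB] [InnerProductSpace ℂ HB]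

lemma opTensor_coe (S : HA →L[ℂ] HA) (T : HB →L[ℂ] HB) (z : HA ⊗[ℂ] HB) :
    opTensor S T (z : JointSpace HA HB) = (mapL S T z : HA ⊗[ℂ] HB) :=
  Completion.map_coe (mapL S T).uniformContinuous z

lemma opTensor_ext {S S' : JointSpace HA HB →L[ℂ] JointSpace HA HB}
    (h : ∀ z : HA ⊗[ℂ] HB, S (z : JointSpace HA HB) = S' (z : JointSpace HA HB)) : S = S' := by
  ext ψ
  induction ψ using Completion.induction_on with
  | hp => exact isClosed_eq S.continuous S'.continuous
  | ih z => exact h z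

lemma opTensor_add_left (S S' : HA →L[ℂ] HA) (T : HB →L[ℂ] HB) :
    opTensor (S + S') T = opTensor S T + opTensor S' T :=
  opTensor_ext fun z => by
    simp only [opTensor_coe, add_apply, mapL_add_left, Completion.coe_add]

lemma opTensor_add_right (S : HA →L[ℂ] HA) (T T' : HB →L[ℂ] HB) :
    opTensor S (T + T') = opTensor S T + opTensor S T' :=
  opTensor_ext fun z => by
    simp only [opTensor_coe, add_apply, mapL_add_right, Completion.coe_add]

lemma opTensor_smul_left (c : ℝ) (S : HA →L[ℂ] HA) (T : HB →L[ℂ] HB) :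
    opTensor (c • S) T = c • opTensor S T := by
  rw [← Complex.coe_smul, ← Complex.coe_smul]
  refine opTensor_ext fun z => ?_
  simp only [opTensor_coe, smul_apply, mapL_smul_left, Completion.coe_smul]

lemma opTensor_smul_right (c : ℝ) (S : HA →L[ℂ] HA) (T : HB →L[ℂ] HB) :
    opTensor S (c • T) = c • opTensor S T := by
  rw [← Complex.coe_smul, ← Complex.coe_smul]
  refine opTensor_ext fun z => ?_
  simp only [opTensor_coe, smul_apply, mapL_smul_right, Completion.coe_smul]

lemma opTensor_mul (S S' : HA →L[ℂ] HA) (T T' : HB →L[ℂ] HB) :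
    opTensor (S * S') (T * T') = opTensor S T * opTensor S' T' :=
  opTensor_ext fun z => by
    simp only [opTensor_coe, mul_apply_eq_comp, mapL_mul]

lemma opTensor_one : opTensor (1 : HA →L[ℂ] HA) (1 : HB →L[ℂ] HB) = 1 :=
  opTensor_ext fun z => by
    rw [opTensor_coe, show mapL (1 : HA →L[ℂ] HA) (1 : HB →L[ℂ] HB) = 1 from mapL_id_id]
    rfl

lemma inner_mapL [CompleteSpace HA] [CompleteSpace HB] (S : HA →L[ℂ] HA) (T : HB →L[ℂ] HB)
    (z w : HA ⊗[ℂ] HB) : ⟪z, mapL S T w⟫_ℂ = ⟪mapL (star S) (star T) z, w⟫_ℂ := by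
  induction z with
  | zero => simp
  | add z z' h h' => rw [inner_add_left, map_add, inner_add_left, h, h']
  | tmul a b =>
    induction w with
    | zero => simp
    | add w w' h h' => rw [map_add, inner_add_right, inner_add_right, h, h']
    | tmul a' b' =>
      simp [ContinuousLinearMap.star_eq_adjoint, ContinuousLinearMap.adjoint_inner_left]

lemma inner_opTensor [CompleteSpace HA] [CompleteSpace HB] (S : HA →L[ℂ] HA) (T : HB →L[ℂ] HB)
    (ψ φ : JointSpace HA HB) :
    ⟪ψ, opTensor S T φ⟫_ℂ = ⟪opTensor (star S) (star T) ψ, φ⟫_ℂ := by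
  induction ψ, φ using Completion.induction_on₂ with
  | hp => exact isClosed_eq (by fun_prop) (by fun_prop)
  | ih z w => rw [opTensor_coe, opTensor_coe, Completion.inner_coe, Completion.inner_coe, inner_mapL]

/-- `S ⊗ T` is positive when `S` and `T` are: writing `S = s† s` and `T = t† t`, it equals
`(s ⊗ t)† (s ⊗ t)`. -/
lemma re_inner_opTensor_nonneg [CompleteSpace HA] [CompleteSpace HB] {S : HA →L[ℂ] HA}
    {T : HB →L[ℂ] HB} (hS : 0 ≤ S) (hT : 0 ≤ T) (ψ : JointSpace HA HB) :
    0 ≤ (⟪ψ, opTensor S T ψ⟫_ℂ).re := by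
  obtain ⟨s, rfl⟩ := CStarAlgebra.nonneg_iff_eq_star_mul_self.mp hS
  obtain ⟨t, rfl⟩ := CStarAlgebra.nonneg_iff_eq_star_mul_self.mp hT
  rw [opTensor_mul, mul_apply_eq_comp, inner_opTensor, star_star, star_star]
  exact inner_self_nonneg (𝕜 := ℂ)

end Operators

/-! ### Correlations and the marginal state of Bob -/

namespace Realisation

variable {d : ℕ} {HA HB : Type*} [NormedAddCommGroup HA] [InnerProductSpace ℂ HA]
  [NormedAddCommGroup HB] [InnerProductSpace ℂ HB] (R : Realisation d HA HB)

lemma summable_re_inner (T : JointSpace HA HB →L[ℂ] JointSpace HA HB) :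
    Summable fun i => (⟪R.ψ i, T (R.ψ i)⟫_ℂ).re := by
  refine .of_norm_bounded (R.hasSum_norm_sq.summable.mul_left ‖T‖) fun i => ?_
  calc ‖(⟪R.ψ i, T (R.ψ i)⟫_ℂ).re‖ ≤ ‖⟪R.ψ i, T (R.ψ i)⟫_ℂ‖ := Complex.abs_re_le_norm _
    _ ≤ ‖R.ψ i‖ * ‖T (R.ψ i)‖ := norm_inner_le_norm _ _
    _ ≤ ‖R.ψ i‖ * (‖T‖ * ‖R.ψ i‖) := by gcongr; exact T.le_opNorm _
    _ = ‖T‖ * ‖R.ψ i‖ ^ 2 := by ring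

lemma expect_add (S T : JointSpace HA HB →L[ℂ] JointSpace HA HB) :
    R.expect (S + T) = R.expect S + R.expect T := by
  rw [expect, expect, expect, ← (R.summable_re_inner S).tsum_add (R.summable_re_inner T)]
  simp only [add_apply, inner_add_right, Complex.add_re]

lemma expect_smul (c : ℝ) (T : JointSpace HA HB →L[ℂ] JointSpace HA HB) :
    R.expect (c • T) = c * R.expect T := by
  rw [expect, expect, ← tsum_mul_left]
  simp only [← Complex.coe_smul, smul_apply, inner_smul_right,
    Complex.re_ofReal_mul]

/-- The correlation `(S, T) ↦ Tr (ρ (S ⊗ T))` of a realisation, as a real bilinear form. -/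
noncomputable def corr : (HA →L[ℂ] HA) →ₗ[ℝ] (HB →L[ℂ] HB) →ₗ[ℝ] ℝ :=
  LinearMap.mk₂ ℝ (fun S T => R.expect (opTensor S T))
    (fun S S' T => by rw [opTensor_add_left, expect_add])
    (fun c S T => by rw [opTensor_smul_left, expect_smul, smul_eq_mul])
    (fun S T T' => by rw [opTensor_add_right, expect_add])
    (fun c S T => by rw [opTensor_smul_right, expect_smul, smul_eq_mul])

lemma corr_apply (S : HA →L[ℂ] HA) (T : HB →L[ℂ] HB) : R.corr S T = R.expect (opTensor S T) :=
  rfl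

lemma corr_one_one : R.corr 1 1 = 1 := by
  rw [corr_apply, opTensor_one, expect, ← R.hasSum_norm_sq.tsum_eq]
  refine tsum_congr fun i => ?_
  exact inner_self_eq_norm_sq (𝕜 := ℂ) (R.ψ i)

lemma corr_nonneg [CompleteSpace HA] [CompleteSpace HB] {S : HA →L[ℂ] HA} {T : HB →L[ℂ] HB}
    (hS : 0 ≤ S) (hT : 0 ≤ T) : 0 ≤ R.corr S T :=
  tsum_nonneg fun _ => re_inner_opTensor_nonneg hS hT _

/-- If `T ≥ 0` and `Tr (ρ_B T) = 0` for a full-rank `ρ_B`, then `T = 0`: by Cauchy–Schwarz for the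
form `⟪·, T ·⟫`, the operator `⟪χ, T χ⟫ • T` dominates `|T χ⟩⟨T χ|`, so `T χ` is in the kernel
of `ρ_B` for every `χ`. -/
lemma BobFullRank.eq_zero_of_corr_eq_zero [CompleteSpace HA] [CompleteSpace HB]
    {R : Realisation d HA HB} (hR : R.BobFullRank) {T : HB →L[ℂ] HB} (hT : 0 ≤ T)
    (h : R.corr 1 T = 0) : T = 0 := by
  have hpos := (ContinuousLinearMap.nonneg_iff_isPositive T).mp hT
  ext χ
  by_contra hχ
  set c : ℝ := (⟪χ, T χ⟫_ℂ).re with hc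
  have key : 0 ≤ c • T - InnerProductSpace.rankOne ℂ (T χ) (T χ) := by
    obtain ⟨s, rfl⟩ := CStarAlgebra.nonneg_iff_eq_star_mul_self.mp hT
    have hs : ∀ η, ⟪η, (star s * s) η⟫_ℂ = ((‖s η‖ ^ 2 : ℝ) : ℂ) := fun η => by
      rw [mul_apply_eq_comp, ContinuousLinearMap.star_eq_adjoint,
        ContinuousLinearMap.adjoint_inner_right, inner_self_eq_norm_sq_to_K]
      norm_cast
    rw [ContinuousLinearMap.nonneg_iff_isPositive, ContinuousLinearMap.isPositive_def']
    refine ⟨.sub (IsSelfAdjoint.smul (.all c) hpos.isSelfAdjoint)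
      (InnerProductSpace.isPositive_rankOne_self _).isSelfAdjoint, fun η => ?_⟩
    rw [← Complex.coe_smul]
    have h1 : ‖⟪(star s * s) χ, η⟫_ℂ‖ ≤ ‖s χ‖ * ‖s η‖ := by
      rw [mul_apply_eq_comp, ContinuousLinearMap.star_eq_adjoint,
        ContinuousLinearMap.adjoint_inner_left]
      exact norm_inner_le_norm _ _
    rw [ContinuousLinearMap.reApplyInnerSelf_apply, inner_re_symm]
    simp only [sub_apply, smul_apply, inner_sub_right,
      inner_smul_right, InnerProductSpace.rankOne_apply, map_sub, hs, hc]
    rw [← inner_conj_symm η, Complex.mul_conj, Complex.normSq_eq_norm_sq]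
    rw [← Complex.ofReal_mul]
    simp only [Complex.ofReal_re, RCLike.re_to_complex]
    nlinarith [norm_nonneg ⟪(star s * s) χ, η⟫_ℂ]
  have h0 := R.corr_nonneg (S := 1) zero_le_one key
  rw [map_sub, map_smul, h, smul_zero, zero_sub] at h0
  have := hR (T χ) hχ
  rw [bobMarginal, ← corr_apply] at this
  linarith

end Realisation

/-! ### Sums over pairs and pairs of projections -/

section Algebra

lemma two_nsmul_sum_pairs {M : Type*} [AddCommMonoid M] {n : ℕ} (g : Fin n → Fin n → M)
    (hsymm : ∀ i j, g i j = g j i) (hdiag : ∀ i, g i i = 0) :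
    2 • ∑ x : Pairs n, g x.1.1 x.1.2 = ∑ i, ∑ j, g i j := by
  have h : ∑ x : Pairs n, g x.1.1 x.1.2
      = ∑ p : Fin n × Fin n, if p.1 < p.2 then g p.1 p.2 else 0 := by
    rw [← Finset.sum_filter]
    exact (Finset.sum_subtype _ (by simp) (fun p : Fin n × Fin n => g p.1 p.2)).symm
  have h' : ∑ x : Pairs n, g x.1.1 x.1.2
      = ∑ p : Fin n × Fin n, if p.2 < p.1 then g p.1 p.2 else 0 := by
    rw [h, ← (Equiv.prodComm _ _).sum_comp]
    exact Finset.sum_congr rfl fun p _ => by simp [hsymm]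
  rw [two_nsmul]
  nth_rw 1 [h]
  rw [h', ← Finset.sum_add_distrib, ← Fintype.sum_prod_type' g]
  refine Finset.sum_congr rfl fun p _ => ?_
  rcases lt_trichotomy p.1 p.2 with hp | hp | hp
  · simp [hp, hp.not_gt]
  · simp [hp, hdiag]
  · simp [hp, hp.not_gt]

lemma sum_pairs_sub_mul_sub {A : Type*} [Ring A] [Module ℝ A] {n : ℕ} (B : Fin n → A) :
    ∑ x : Pairs n, (B x.1.1 - B x.1.2) * (B x.1.1 - B x.1.2)
      = (n : ℝ) • ∑ i, B i * B i - (∑ i, B i) * ∑ i, B i := by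
  have h := two_nsmul_sum_pairs (fun i j => (B i - B j) * (B i - B j))
    (fun i j => by noncomm_ring) (fun i => by simp)
  have h2 : ∑ i, ∑ j, (B i - B j) * (B i - B j)
      = (2 : ℝ) • ((n : ℝ) • ∑ i, B i * B i - (∑ i, B i) * ∑ i, B i) := by
    simp only [sub_mul, mul_sub, Finset.sum_sub_distrib, Finset.sum_const, Finset.card_univ,
      Fintype.card_fin, ← Finset.smul_sum, ← Nat.cast_smul_eq_nsmul ℝ]
    simp only [← Finset.mul_sum, ← Finset.sum_mul]
    module
  rw [h2, ← Nat.cast_smul_eq_nsmul ℝ] at h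
  exact smul_right_injective A (two_ne_zero : (2 : ℝ) ≠ 0) (by simpa using h)

variable {A : Type*}

lemma sub_smul_one_mul_self [Ring A] [Algebra ℝ A] (D : A) (t : ℝ) :
    (D - t • 1) * (D - t • 1) = D * D - (2 * t) • D + t ^ 2 • (1 : A) := by
  simp only [sub_mul, mul_sub, mul_smul_comm, smul_mul_assoc, mul_one, one_mul]
  module

lemma add_smul_one_mul_self [Ring A] [Algebra ℝ A] (D : A) (t : ℝ) :
    (D + t • 1) * (D + t • 1) = D * D + (2 * t) • D + t ^ 2 • (1 : A) := by
  simp only [add_mul, mul_add, mul_smul_comm, smul_mul_assoc, mul_one, one_mul]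
  module

/-- `b - b² = b (1 - b) b + (1 - b) b (1 - b)`. -/
lemma sub_mul_self_nonneg [Ring A] [PartialOrder A] [StarRing A] [StarOrderedRing A] {b : A}
    (h0 : 0 ≤ b) (h1 : b ≤ 1) : 0 ≤ b - b * b := by
  have hb : IsSelfAdjoint b := .of_nonneg h0
  have e : b - b * b = star b * (1 - b) * b + star (1 - b) * b * (1 - b) := by
    rw [star_sub, star_one, hb.star_eq]
    noncomm_ring
  rw [e]
  exact add_nonneg (star_left_conjugate_nonneg (sub_nonneg.mpr h1) b)
    (star_left_conjugate_nonneg h0 (1 - b))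

lemma norm_smul_sub_conjugate_nonneg [CStarAlgebra A] [PartialOrder A] [StarOrderedRing A]
    (u v : A) : 0 ≤ ‖star v * v‖ • (star u * u) - star u * (star v * v) * u :=
  sub_nonneg.mpr (CStarAlgebra.star_left_conjugate_le_norm_smul (.star_mul_self v))

/-- If the difference of two projections `p` and `q` satisfies `D³ = t D`, then `p q p` has no
spectrum on the range of `p` other than `1 - t` and `1`. -/
lemma sandwich_sub_mul_self [Ring A] [Algebra ℝ A] {p q : A} (hp : p * p = p) (hq : q * q = q)
    {t : ℝ} (h : (p - q) * (p - q) * (p - q) = t • (p - q)) :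
    (p * q * p - (1 - t) • p) * (p * q * p - (1 - t) • p) = t • (p * q * p - (1 - t) • p) := by
  have hp' : ∀ z, p * (p * z) = p * z := fun z => by rw [← mul_assoc, hp]
  have h2 := congrArg (fun z => p * (z * p)) h
  simp only [sub_mul, mul_sub, mul_assoc, hp, hq, hp', smul_mul_assoc, mul_smul_comm,
    smul_sub] at h2 ⊢
  rw [← sub_eq_zero] at h2 ⊢
  rw [← h2]
  module

/-- Projections that sum to `d` and whose differences satisfy `D³ = d / (d + 1) D` are such that
`p q p = p / (d + 1)`: each `p q p - p / (d + 1)` is positive, and for fixed `p` these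
operators sum to zero. -/
lemma sandwich_eq [CStarAlgebra A] [PartialOrder A] [StarOrderedRing A] {d : ℕ} (hd : d ≠ 0)
    {B : Fin (d ^ 2) → A} (hB : ∀ y, IsStarProjection (B y)) (hsum : ∑ y, B y = (d : ℝ) • 1)
    (h : ∀ y y', y ≠ y' → (B y - B y') * (B y - B y') * (B y - B y')
      = ((d : ℝ) / (d + 1)) • (B y - B y'))
    {y y' : Fin (d ^ 2)} (hy : y ≠ y') :
    B y * B y' * B y = (1 - (d : ℝ) / (d + 1)) • B y := by
  set t : ℝ := (d : ℝ) / (d + 1) with ht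
  have hd' : (0 : ℝ) < d := by positivity
  have htpos : 0 < t := by positivity
  have hmul : ∀ y, B y * B y = B y := fun y => (hB y).isIdempotentElem
  have hstar : ∀ y, star (B y) = B y := fun y => (hB y).isSelfAdjoint
  have hpos : ∀ z ∈ Finset.univ.erase y, 0 ≤ B y * B z * B y - (1 - t) • B y := fun z hz => by
    have e := sandwich_sub_mul_self (hmul y) (hmul z) (h y z (Finset.ne_of_mem_erase hz).symm)
    have hsa : star (B y * B z * B y - (1 - t) • B y) = B y * B z * B y - (1 - t) • B y := by
      simp [hstar, mul_assoc]
    have e' : B y * B z * B y - (1 - t) • B y = t⁻¹ •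
        (star (B y * B z * B y - (1 - t) • B y) * (B y * B z * B y - (1 - t) • B y)) := by
      rw [hsa, e, inv_smul_smul₀ htpos.ne']
    rw [e']
    exact smul_nonneg (by positivity) (star_mul_self_nonneg _)
  have hzero : ∑ z ∈ Finset.univ.erase y, (B y * B z * B y - (1 - t) • B y) = 0 := by
    have e : ∑ z ∈ Finset.univ.erase y, B z = (d : ℝ) • 1 - B y := by
      rw [← hsum, Finset.sum_erase_eq_sub (Finset.mem_univ y)]
    rw [Finset.sum_sub_distrib, ← Finset.sum_mul, ← Finset.mul_sum, e, Finset.sum_const,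
      Finset.card_erase_of_mem (Finset.mem_univ y), Finset.card_univ, Fintype.card_fin,
      ← Nat.cast_smul_eq_nsmul ℝ, Nat.cast_sub (Nat.one_le_pow _ _ (Nat.pos_of_ne_zero hd)),
      mul_sub, sub_mul, mul_smul_comm, mul_one, smul_mul_assoc, hmul, hmul, smul_smul]
    have : ((d ^ 2 : ℕ) - (1 : ℕ) : ℝ) * (1 - t) = d - 1 := by
      rw [ht]; push_cast; field_simp; ring
    rw [this]
    module
  exact sub_eq_zero.mp ((Finset.sum_eq_zero_iff_of_nonneg hpos).mp hzero y'
    (Finset.mem_erase.mpr ⟨hy.symm, Finset.mem_univ _⟩))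

end Algebra

/-! ### Operational SICs -/

section Operational

variable {H : Type*} [NormedAddCommGroup H] [InnerProductSpace ℂ H] [CompleteSpace H]

lemma apply_eq_self_of_inner_eq_one {P : H →L[ℂ] H} (hP : IsStarProjection P) {φ : H}
    (hφ : ‖φ‖ = 1) (h : ⟪φ, P φ⟫_ℂ = 1) : P φ = φ := by
  have hPP : ⟪P φ, P φ⟫_ℂ = 1 := by
    rw [← h]
    nth_rw 1 [← hP.isSelfAdjoint.star_eq]
    rw [ContinuousLinearMap.star_eq_adjoint, ContinuousLinearMap.adjoint_inner_left,
      ← mul_apply_eq_comp, hP.isIdempotentElem.eq]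
  rw [← sub_eq_zero, ← inner_self_eq_zero (𝕜 := ℂ), inner_sub_left, inner_sub_right,
    inner_sub_right, hPP, h, ← inner_conj_symm, h, inner_self_eq_norm_sq_to_K, hφ]
  simp

/-- Unbiasedness fixes the quadratic form of `B b` on the range of `B a`, and over `ℂ` a quadratic
form determines its operator. -/
theorem sicRelations_iff_isOperationalSIC {d : ℕ} (B : Fin (d ^ 2) → H →L[ℂ] H) :
    SICRelations d B ↔ IsOperationalSIC d B := by
  have hd : (d : ℂ) + 1 ≠ 0 := by exact_mod_cast d.succ_ne_zero
  constructor
  · refine fun h => ⟨h.isStarProjection, h.sum_eq, fun a b hab φ hφ h1 => ?_⟩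
    have hfix := apply_eq_self_of_inner_eq_one (h.isStarProjection a) hφ h1
    have e : ⟪φ, (B a * B b * B a) φ⟫_ℂ = ⟪φ, B b φ⟫_ℂ := by
      rw [mul_apply_eq_comp, mul_apply_eq_comp, hfix,
        ← (h.isStarProjection a).isSelfAdjoint.star_eq, ContinuousLinearMap.star_eq_adjoint,
        ContinuousLinearMap.adjoint_inner_right, hfix]
    rw [h.sandwich a b hab, smul_apply, inner_smul_right, e] at h1
    rw [eq_div_iff hd, mul_comm, h1]
  · refine fun h => ⟨h.isStarProjection, h.sum_eq, fun a b hab => ?_⟩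
    have hsa := (h.isStarProjection a).isSelfAdjoint.star_eq
    have hmul := (h.isStarProjection a).isIdempotentElem.eq
    have hinner : ∀ u v, ⟪u, B a v⟫_ℂ = ⟪B a u, v⟫_ℂ := fun u v => by
      nth_rw 1 [← hsa]
      rw [ContinuousLinearMap.star_eq_adjoint, ContinuousLinearMap.adjoint_inner_right]
    -- The quadratic forms of both sides agree on every vector, as seen on the normalisation of
    -- its projection to the range of `B a`.
    suffices (B a : H →ₗ[ℂ] H) = (((d : ℂ) + 1) • (B a * B b * B a) : H →L[ℂ] H) from
      ContinuousLinearMap.coe_injective this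
    rw [← ext_inner_map]
    intro χ
    have hχ : B a (B a χ) = B a χ := by rw [← mul_apply_eq_comp, hmul]
    suffices hs : ⟪χ, B a χ⟫_ℂ = ((d : ℂ) + 1) * ⟪B a χ, B b (B a χ)⟫_ℂ by
      have e : ⟪χ, B a χ⟫_ℂ = ⟪χ, (((d : ℂ) + 1) • (B a * B b * B a) : H →L[ℂ] H) χ⟫_ℂ := by
        rw [hs, smul_apply, inner_smul_right, mul_apply_eq_comp, mul_apply_eq_comp, hinner]
      simpa only [inner_conj_symm, ContinuousLinearMap.coe_coe] using congrArg (starRingEnd ℂ) e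
    rw [← hχ, hinner, hχ]
    rcases eq_or_ne (B a χ) 0 with h0 | h0
    · simp [h0]
    set φ := B a χ
    have hn : (‖φ‖ : ℂ) ≠ 0 := by simpa using h0
    have hunit : ‖((‖φ‖ : ℂ)⁻¹) • φ‖ = 1 := by simp [norm_smul, h0]
    have := h.unbiased a b hab _ hunit (by
      rw [map_smul, hχ, inner_self_eq_norm_sq_to_K, hunit]; simp)
    rw [map_smul, inner_smul_left, inner_smul_right, map_inv₀, Complex.conj_ofReal] at this
    rw [inner_self_eq_norm_sq_to_K]
    field_simp at this ⊢
    simpa [mul_comm] using this.symm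

end Operational

/-! ### The constants of the Bell functional -/

section Constants

/-- The positive eigenvalue `√(d / (d + 1))` of the difference of two rank-one projections of a SIC
in dimension `d`. -/
noncomputable def gap (d : ℕ) : ℝ := √((d : ℝ) / (d + 1))

/-- The amount `gap d / 2 - α d` by which Alice's penalty falls short of half the gap; it vanishes
unless `d = 2`. -/
noncomputable def shortfall (d : ℕ) : ℝ := if d = 2 then gap d / 2 else 0

variable {d : ℕ}

lemma gap_pos (hd : d ≠ 0) : 0 < gap d :=
  Real.sqrt_pos.mpr (by positivity)

lemma gap_sq : gap d ^ 2 = (d : ℝ) / (d + 1) :=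
  Real.sq_sqrt (by positivity)

lemma shortfall_nonneg : 0 ≤ shortfall d := by
  unfold shortfall gap
  split_ifs <;> positivity

lemma sqrt_eq_div_gap (hd : d ≠ 0) : √((d : ℝ) * (d + 1)) = d / gap d := by
  rw [eq_div_iff (gap_pos hd).ne', gap, ← Real.sqrt_mul (by positivity)]
  rw [show (d : ℝ) * (d + 1) * (d / (d + 1)) = d ^ 2 by field_simp]
  exact Real.sqrt_sq (by positivity)

lemma α_eq : α d = gap d / 2 - shortfall d := by
  unfold α shortfall gap
  split_ifs <;> ring

lemma β_eq (hd : d ≠ 0) : β d = d * (d - 2) * (2 * gap d)⁻¹ := by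
  rw [β, sqrt_eq_div_gap hd]
  have := (gap_pos hd).ne'
  field_simp

lemma two_mul_card_pairs (n : ℕ) : 2 * (Fintype.card (Pairs n) : ℝ) = n * (n - 1) := by
  have h := two_nsmul_sum_pairs (n := n) (fun i j => if i = j then (0 : ℝ) else 1)
    (fun i j => by simp only [eq_comm]) (fun i => if_pos rfl)
  have h1 : ∑ x : Pairs n, (if x.1.1 = x.1.2 then (0 : ℝ) else 1) = Fintype.card (Pairs n) := by
    rw [Finset.sum_congr rfl fun x _ => if_neg x.2.ne]
    simp
  have h2 : ∀ i : Fin n, ∑ j, (if i = j then (0 : ℝ) else 1) = n - 1 := fun i => by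
    rw [Finset.sum_congr rfl fun j _ => (by split_ifs <;> ring :
      (if i = j then (0 : ℝ) else 1) = 1 - if i = j then 1 else 0)]
    simp
  simpa [h1, h2, mul_sub] using h

/-- The second term matters only for `d = 2`, where there are six pairs. -/
lemma quantumValue_eq (hd : d ≠ 0) :
    quantumValue d = d ^ 2 * (2 * gap d)⁻¹ + Fintype.card (Pairs (d ^ 2)) * shortfall d := by
  have hg := gap_pos hd
  rw [quantumValue, sqrt_eq_div_gap hd, shortfall]
  split_ifs with h
  · have hN := two_mul_card_pairs (d ^ 2)
    have hsq := gap_sq (d := d)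
    rw [show ((d ^ 2 : ℕ) : ℝ) = 4 by rw [h]; norm_num] at hN
    rw [show (Fintype.card (Pairs (d ^ 2)) : ℝ) = 6 by linarith]
    subst h
    push_cast at hsq ⊢
    field_simp
    rw [hsq]
    norm_num
  · field_simp
    ring

end Constants

/-! ### The sum-of-squares decomposition and its equality case -/

namespace Realisation

variable {d : ℕ} {HA HB : Type*} [NormedAddCommGroup HA] [InnerProductSpace ℂ HA]
  [NormedAddCommGroup HB] [InnerProductSpace ℂ HB] (R : Realisation d HA HB)

/-- The difference `B x₁ - B x₂` of Bob's operators. -/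
def diff (x : Pairs (d ^ 2)) : HB →L[ℂ] HB := R.B x.1.1 - R.B x.1.2

/-- The contribution of Alice's input `x` to `quantumValue d - R.scoreS`. For each of Alice's
outcomes Bob's operator is, up to the shortfall, a multiple of the square of a factor of
`D³ - gap² D`, where `D` is `R.diff x`. -/
noncomputable def slack (x : Pairs (d ^ 2)) : ℝ :=
  (2 * gap d)⁻¹ * R.corr ((R.alice x).effect 0)
      ((R.diff x - gap d • 1) * (R.diff x - gap d • 1)) +
    (2 * gap d)⁻¹ * R.corr ((R.alice x).effect 1)
      ((R.diff x + gap d • 1) * (R.diff x + gap d • 1)) +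
    ((2 * gap d)⁻¹ * R.corr ((R.alice x).effect 2) (R.diff x * R.diff x) +
      shortfall d * R.corr ((R.alice x).effect 2) 1)

lemma slack_eq (hd : d ≠ 0) (x : Pairs (d ^ 2)) :
    R.slack x = (2 * gap d)⁻¹ * R.corr 1 (R.diff x * R.diff x) + shortfall d -
      (R.corr ((R.alice x).effect 0) (R.diff x) - R.corr ((R.alice x).effect 1) (R.diff x)) +
      α d * (R.corr ((R.alice x).effect 0) 1 + R.corr ((R.alice x).effect 1) 1) := by
  have hg := (gap_pos hd).ne'
  have h2 : (R.alice x).effect 2 = 1 - (R.alice x).effect 0 - (R.alice x).effect 1 := by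
    rw [← (R.alice x).sum_effect, Fin.sum_univ_three]
    abel
  rw [slack, h2, sub_smul_one_mul_self, add_smul_one_mul_self, α_eq]
  simp only [map_add, map_sub, map_smul, LinearMap.sub_apply, corr_one_one, smul_eq_mul]
  field_simp
  ring

lemma scoreS_eq : R.scoreS =
    ∑ x, (R.corr ((R.alice x).effect 0) (R.diff x) - R.corr ((R.alice x).effect 1) (R.diff x)) -
      α d * ∑ x, (R.corr ((R.alice x).effect 0) 1 + R.corr ((R.alice x).effect 1) 1) -
      β d * ∑ y, R.corr 1 (R.B y) := by
  simp only [scoreS, scoreR, prob, probA, probB, ← corr_apply, diff, B, map_sub]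
  congr 2
  exact Finset.sum_congr rfl fun x _ => by ring

/-- The sum-of-squares decomposition of the Bell functional. -/
lemma quantumValue_sub_scoreS (hd : d ≠ 0) :
    quantumValue d - R.scoreS = ∑ x, R.slack x +
      d ^ 2 * (2 * gap d)⁻¹ * ∑ y, R.corr 1 (R.B y - R.B y * R.B y) +
      (2 * gap d)⁻¹ * R.corr 1 ((∑ y, R.B y - (d : ℝ) • 1) * (∑ y, R.B y - (d : ℝ) • 1)) := by
  have h := congrArg (R.corr 1) (sum_pairs_sub_mul_sub R.B)
  rw [map_sub, map_smul, map_sum, map_sum, smul_eq_mul] at h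
  change ∑ x, R.corr 1 (R.diff x * R.diff x) = _ at h
  simp only [slack_eq R hd, scoreS_eq, quantumValue_eq hd, β_eq hd, sub_smul_one_mul_self,
    Finset.sum_add_distrib, Finset.sum_sub_distrib, ← Finset.mul_sum, h, map_add, map_sub, map_smul,
    map_sum, Finset.sum_const, Finset.card_univ, nsmul_eq_mul, smul_eq_mul, corr_one_one]
  push_cast
  ring

lemma B_nonneg (y : Fin (d ^ 2)) : 0 ≤ R.B y :=
  (ContinuousLinearMap.nonneg_iff_isPositive _).mpr ((R.bob y).isPositive 0)

lemma B_le_one (y : Fin (d ^ 2)) : R.B y ≤ 1 := by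
  rw [ContinuousLinearMap.le_def, ← (R.bob y).sum_effect, Fin.sum_univ_two, B, add_sub_cancel_left]
  exact (R.bob y).isPositive 1

lemma effect_nonneg (x : Pairs (d ^ 2)) (a : Fin 3) : 0 ≤ (R.alice x).effect a :=
  (ContinuousLinearMap.nonneg_iff_isPositive _).mpr ((R.alice x).isPositive a)

variable [CompleteSpace HB]

lemma isSelfAdjoint_B (y : Fin (d ^ 2)) : IsSelfAdjoint (R.B y) := .of_nonneg (R.B_nonneg y)

lemma isSelfAdjoint_diff (x : Pairs (d ^ 2)) : IsSelfAdjoint (R.diff x) :=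
  (R.isSelfAdjoint_B _).sub (R.isSelfAdjoint_B _)

lemma isSelfAdjoint_diff_sub (x : Pairs (d ^ 2)) (t : ℝ) : IsSelfAdjoint (R.diff x - t • 1) :=
  (R.isSelfAdjoint_diff x).sub (.smul (.all t) (.one _))

lemma isSelfAdjoint_diff_add (x : Pairs (d ^ 2)) (t : ℝ) : IsSelfAdjoint (R.diff x + t • 1) :=
  (R.isSelfAdjoint_diff x).add (.smul (.all t) (.one _))

lemma isSelfAdjoint_sum_B_sub (t : ℝ) : IsSelfAdjoint (∑ y, R.B y - t • 1) :=
  (isSelfAdjoint_sum _ fun y _ => R.isSelfAdjoint_B y).sub (.smul (.all t) (.one _))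

variable [CompleteSpace HA]

lemma corr_sub_nonneg (x : Pairs (d ^ 2)) : 0 ≤ R.corr ((R.alice x).effect 0)
    ((R.diff x - gap d • 1) * (R.diff x - gap d • 1)) :=
  R.corr_nonneg (R.effect_nonneg x 0) (R.isSelfAdjoint_diff_sub x _).mul_self_nonneg

lemma corr_add_nonneg (x : Pairs (d ^ 2)) : 0 ≤ R.corr ((R.alice x).effect 1)
    ((R.diff x + gap d • 1) * (R.diff x + gap d • 1)) :=
  R.corr_nonneg (R.effect_nonneg x 1) (R.isSelfAdjoint_diff_add x _).mul_self_nonneg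

lemma corr_diff_nonneg (x : Pairs (d ^ 2)) :
    0 ≤ R.corr ((R.alice x).effect 2) (R.diff x * R.diff x) :=
  R.corr_nonneg (R.effect_nonneg x 2) (R.isSelfAdjoint_diff x).mul_self_nonneg

lemma corr_effect_one_nonneg (x : Pairs (d ^ 2)) : 0 ≤ R.corr ((R.alice x).effect 2) 1 :=
  R.corr_nonneg (R.effect_nonneg x 2) zero_le_one

lemma slack_nonneg (hd : d ≠ 0) (x : Pairs (d ^ 2)) : 0 ≤ R.slack x := by
  have h1 := R.corr_sub_nonneg x
  have h2 := R.corr_add_nonneg x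
  have h3 := R.corr_diff_nonneg x
  have h4 := R.corr_effect_one_nonneg x
  have hg := gap_pos hd
  have hs := shortfall_nonneg (d := d)
  unfold slack
  positivity

lemma corr_B_sub_nonneg (y : Fin (d ^ 2)) : 0 ≤ R.corr 1 (R.B y - R.B y * R.B y) :=
  R.corr_nonneg zero_le_one (sub_mul_self_nonneg (R.B_nonneg y) (R.B_le_one y))

lemma corr_sum_B_nonneg :
    0 ≤ R.corr 1 ((∑ y, R.B y - (d : ℝ) • 1) * (∑ y, R.B y - (d : ℝ) • 1)) :=
  R.corr_nonneg zero_le_one (R.isSelfAdjoint_sum_B_sub d).mul_self_nonneg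

theorem scoreS_le (hd : d ≠ 0) : R.scoreS ≤ quantumValue d := by
  have h1 := Finset.sum_nonneg fun x (_ : x ∈ Finset.univ) => R.slack_nonneg hd x
  have h2 := Finset.sum_nonneg fun y (_ : y ∈ Finset.univ) => R.corr_B_sub_nonneg y
  have h3 := R.corr_sum_B_nonneg
  have hg := gap_pos hd
  have := R.quantumValue_sub_scoreS hd
  rw [← sub_nonneg, this]
  exact add_nonneg (add_nonneg h1 (mul_nonneg (by positivity) h2)) (mul_nonneg (by positivity) h3)

/-- If `Tr (ρ (S ⊗ U²)) = 0`, then the same holds for every operator `V U` in place of the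
self-adjoint `U`, because `(V U)† (V U) ≤ ‖V† V‖ • U²`. -/
lemma corr_mul_self_eq_zero {S : HA →L[ℂ] HA} (hS : 0 ≤ S) {U : HB →L[ℂ] HB}
    (hU : IsSelfAdjoint U) (h : R.corr S (U * U) = 0) (V : HB →L[ℂ] HB) :
    R.corr S (star (V * U) * (V * U)) = 0 := by
  refine le_antisymm ?_ (R.corr_nonneg hS (star_mul_self_nonneg _))
  have hle : 0 ≤ ‖star V * V‖ • (star U * U) - star U * (star V * V) * U :=
    norm_smul_sub_conjugate_nonneg U V
  have := R.corr_nonneg hS hle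
  rw [map_sub, map_smul, hU.star_eq, h, smul_zero, zero_sub] at this
  rw [star_mul, hU.star_eq, show U * star V * (V * U) = U * (star V * V) * U by noncomm_ring]
  linarith

/-- Each of the three squares in `slack` is the square of a factor of `D³ - gap² D`; so if they have
expectation zero for Alice's three outcomes, then `D³ - gap² D` is annihilated by Bob's marginal
state. -/
lemma diff_cubed (hd : d ≠ 0) (hR : R.BobFullRank) {x : Pairs (d ^ 2)} (h : R.slack x = 0) :
    R.diff x * R.diff x * R.diff x = gap d ^ 2 • R.diff x := by
  have h1 := R.corr_sub_nonneg x
  have h2 := R.corr_add_nonneg x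
  have h3 := R.corr_diff_nonneg x
  have h4 := R.corr_effect_one_nonneg x
  have hc : 0 < (2 * gap d)⁻¹ := by have := gap_pos hd; positivity
  have hs := mul_nonneg (shortfall_nonneg (d := d)) h4
  rw [slack] at h
  have e1 := R.corr_mul_self_eq_zero (R.effect_nonneg x 0) (R.isSelfAdjoint_diff_sub x _)
    (by nlinarith) (R.diff x * (R.diff x + gap d • 1))
  have e2 := R.corr_mul_self_eq_zero (R.effect_nonneg x 1) (R.isSelfAdjoint_diff_add x _)
    (by nlinarith) (R.diff x * (R.diff x - gap d • 1))
  have e3 := R.corr_mul_self_eq_zero (R.effect_nonneg x 2) (R.isSelfAdjoint_diff x)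
    (by nlinarith) (R.diff x * R.diff x - gap d ^ 2 • 1)
  set D := R.diff x
  set W := D * D * D - gap d ^ 2 • D with hW
  have w1 : D * (D + gap d • 1) * (D - gap d • 1) = W := by
    simp only [mul_add, mul_sub, add_mul, smul_mul_assoc, mul_smul_comm, mul_one, hW]
    module
  have w2 : D * (D - gap d • 1) * (D + gap d • 1) = W := by
    simp only [mul_add, mul_sub, sub_mul, smul_mul_assoc, mul_smul_comm, mul_one, hW]
    module
  have w3 : (D * D - gap d ^ 2 • 1) * D = W := by
    simp only [sub_mul, smul_mul_assoc, one_mul, hW]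
  rw [w1] at e1
  rw [w2] at e2
  rw [w3] at e3
  have e : R.corr 1 (star W * W) = 0 := by
    rw [← (R.alice x).sum_effect, map_sum, LinearMap.sum_apply, Fin.sum_univ_three, e1, e2, e3]
    norm_num
  have := hR.eq_zero_of_corr_eq_zero (star_mul_self_nonneg W) e
  exact sub_eq_zero.mp ((CStarRing.star_mul_self_eq_zero_iff W).mp this)

/-- If the bound is attained, every term of the decomposition vanishes. As Bob's marginal state is
faithful, this turns `Tr (ρ_B T) = 0` for positive `T` into `T = 0`, which makes the operators
projections with sum `d` whose differences satisfy `D³ = gap² D`; `sandwich_eq` does the rest. -/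
theorem sicRelations_B (hd : d ≠ 0) (hR : R.BobFullRank) (h : R.scoreS = quantumValue d) :
    SICRelations d R.B := by
  have hdec := R.quantumValue_sub_scoreS hd
  have h1 := Finset.sum_nonneg fun x (_ : x ∈ Finset.univ) => R.slack_nonneg hd x
  have h2 := Finset.sum_nonneg fun y (_ : y ∈ Finset.univ) => R.corr_B_sub_nonneg y
  have h3 := R.corr_sum_B_nonneg
  have hc : 0 < (2 * gap d)⁻¹ := by have := gap_pos hd; positivity
  have hc' : 0 < d ^ 2 * (2 * gap d)⁻¹ := by positivity
  rw [h, sub_self] at hdec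
  have z1 : ∑ x, R.slack x = 0 := by nlinarith
  have z2 : ∑ y, R.corr 1 (R.B y - R.B y * R.B y) = 0 := by nlinarith
  have z3 : R.corr 1 ((∑ y, R.B y - (d : ℝ) • 1) * (∑ y, R.B y - (d : ℝ) • 1)) = 0 := by nlinarith
  rw [Finset.sum_eq_zero_iff_of_nonneg fun x _ => R.slack_nonneg hd x] at z1
  rw [Finset.sum_eq_zero_iff_of_nonneg fun y _ => R.corr_B_sub_nonneg y] at z2
  have hproj : ∀ y, IsStarProjection (R.B y) := fun y => by
    refine ⟨?_, R.isSelfAdjoint_B y⟩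
    have := hR.eq_zero_of_corr_eq_zero
      (sub_mul_self_nonneg (R.B_nonneg y) (R.B_le_one y)) (z2 y (Finset.mem_univ _))
    exact (sub_eq_zero.mp this).symm
  have hsum : ∑ y, R.B y = (d : ℝ) • 1 := by
    have hsa := R.isSelfAdjoint_sum_B_sub d
    have := hR.eq_zero_of_corr_eq_zero hsa.mul_self_nonneg z3
    nth_rw 1 [← hsa.star_eq] at this
    exact sub_eq_zero.mp ((CStarRing.star_mul_self_eq_zero_iff _).mp this)
  have hcube : ∀ y y', y ≠ y' → (R.B y - R.B y') * (R.B y - R.B y') * (R.B y - R.B y')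
      = ((d : ℝ) / (d + 1)) • (R.B y - R.B y') := by
    have hlt : ∀ y y', y < y' → (R.B y - R.B y') * (R.B y - R.B y') * (R.B y - R.B y')
        = ((d : ℝ) / (d + 1)) • (R.B y - R.B y') := fun y y' hy => by
      rw [← gap_sq]
      exact R.diff_cubed hd hR (z1 ⟨(y, y'), hy⟩ (Finset.mem_univ _))
    intro y y' hy
    rcases hy.lt_or_gt with hy | hy
    · exact hlt y y' hy
    · rw [← neg_sub (R.B y') (R.B y), neg_mul_neg, mul_neg, hlt y' y hy, smul_neg]
  refine ⟨hproj, ?_, fun y y' hy => ?_⟩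
  · rw [hsum, ← Complex.coe_smul]
    norm_cast
  · rw [sandwich_eq hd hproj hsum hcube hy, ← Complex.coe_smul, smul_smul]
    have hd1 : (d : ℂ) + 1 ≠ 0 := by exact_mod_cast d.succ_ne_zero
    rw [show ((d : ℂ) + 1) * ((1 - (d : ℝ) / (d + 1) : ℝ) : ℂ) = 1 by
      push_cast; field_simp; ring, one_smul]

end Realisation

/-! ### The realisation on a maximally entangled state -/

section Algebra

variable {A : Type*} [Ring A]

/-- If `pqp = (1 - t) p` and `qpq = (1 - t) q`, then `D = p - q` satisfies `D³ = t D`. -/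
lemma diff_cubed_of_sandwich [Module ℝ A] {p q : A} (hp : p * p = p) (hq : q * q = q) {t : ℝ}
    (hpq : p * q * p = (1 - t) • p) (hqp : q * p * q = (1 - t) • q) :
    (p - q) * (p - q) * (p - q) = t • (p - q) := by
  have e : (p - q) * (p - q) * (p - q) = p - q - p * q * p + q * p * q := by
    simp only [sub_mul, mul_sub, hp, hq]
    simp only [mul_assoc, hp, hq]
    abel
  rw [e, hpq, hqp]
  module

variable [Algebra ℝ A] [StarRing A] [StarModule ℝ A]

/-- The spectral projection `(D² + g D) / (2 g²)` of a self-adjoint `D` with `D³ = g² D` for the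
eigenvalue `g`. -/
lemma isStarProjection_spectral {D : A} {g : ℝ} (hg : g ≠ 0) (hD : IsSelfAdjoint D)
    (h : D * D * D = g ^ 2 • D) : IsStarProjection ((2 * g ^ 2)⁻¹ • (D * D + g • D)) := by
  refine ⟨?_, ?_⟩
  · have h4 : D * D * (D * D) = g ^ 2 • (D * D) := by rw [← mul_assoc, h, smul_mul_assoc]
    rw [IsIdempotentElem, smul_mul_smul_comm, add_mul, mul_add, mul_add, h4, mul_smul_comm,
      smul_mul_assoc, h, ← mul_assoc, smul_mul_assoc, h, mul_smul_comm]
    match_scalars <;> field_simp <;> ring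
  · exact .smul (.all _) ((by simpa [sq] using hD.pow 2 : IsSelfAdjoint (D * D)).add
      (.smul (.all _) hD))

lemma isStarProjection_kernel {D : A} {g : ℝ} (hg : g ≠ 0) (hD : IsSelfAdjoint D)
    (h : D * D * D = g ^ 2 • D) : IsStarProjection (1 - (g ^ 2)⁻¹ • (D * D)) := by
  refine IsStarProjection.one_sub ⟨?_, ?_⟩
  · have h4 : D * D * (D * D) = g ^ 2 • (D * D) := by rw [← mul_assoc, h, smul_mul_assoc]
    rw [IsIdempotentElem, smul_mul_smul_comm, h4]
    match_scalars
    field_simp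
  · exact .smul (.all _) (by simpa [sq] using hD.pow 2 : IsSelfAdjoint (D * D))

end Algebra

section MaximallyEntangled

open Matrix

variable {d : ℕ}

/-- The vector `d^(-1/2) ∑ i, b i ⊗ b i`. -/
noncomputable def maxEntangledVec {H : Type*} [NormedAddCommGroup H] [InnerProductSpace ℂ H]
    (b : Fin d → H) : H ⊗[ℂ] H :=
  ((√(d : ℝ) : ℝ) : ℂ)⁻¹ • ∑ i, b i ⊗ₜ[ℂ] b i

lemma inner_maxEntangledVec {H : Type*} [NormedAddCommGroup H] [InnerProductSpace ℂ H]
    (b : Fin d → H) (S T : H →L[ℂ] H) :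
    ⟪maxEntangledVec b, mapL S T (maxEntangledVec b)⟫_ℂ
      = (d : ℂ)⁻¹ * ∑ j, ∑ i, ⟪b i, S (b j)⟫_ℂ * ⟪b i, T (b j)⟫_ℂ := by
  have hd : ((√(d : ℝ) : ℝ) : ℂ)⁻¹ * ((√(d : ℝ) : ℝ) : ℂ)⁻¹ = (d : ℂ)⁻¹ := by
    rw [← mul_inv, ← Complex.ofReal_mul, Real.mul_self_sqrt d.cast_nonneg]
    simp
  have hl : ∀ (c : ℂ) (z w : H ⊗[ℂ] H), ⟪c • z, w⟫_ℂ = starRingEnd ℂ c * ⟪z, w⟫_ℂ :=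
    fun c z w => inner_smul_left z w c
  have hr : ∀ (c : ℂ) (z w : H ⊗[ℂ] H), ⟪z, c • w⟫_ℂ = c * ⟪z, w⟫_ℂ :=
    fun c z w => inner_smul_right z w c
  rw [maxEntangledVec, map_smul, hl, hr, map_inv₀, Complex.conj_ofReal,
    ← mul_assoc, hd, map_sum, inner_sum]
  simp only [sum_inner, mapL_tmul, inner_tmul]

/-- The maximally entangled vector of `ℂᵈ ⊗ ℂᵈ`. -/
noncomputable def maxEntangledState (d : ℕ) :
    JointSpace (EuclideanSpace ℂ (Fin d)) (EuclideanSpace ℂ (Fin d)) :=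
  (maxEntangledVec fun i : Fin d => EuclideanSpace.single i (1 : ℂ) :)

lemma inner_maxEntangledState (M N : Matrix (Fin d) (Fin d) ℂ) :
    ⟪maxEntangledState d, opTensor (toEuclideanCLM (𝕜 := ℂ) Mᵀ) (toEuclideanCLM (𝕜 := ℂ) N)
      (maxEntangledState d)⟫_ℂ = (d : ℂ)⁻¹ * (M * N).trace := by
  have he : ∀ (L : Matrix (Fin d) (Fin d) ℂ) i j,
      ⟪EuclideanSpace.single i (1 : ℂ), toEuclideanCLM (𝕜 := ℂ) L (EuclideanSpace.single j 1)⟫_ℂ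
        = L i j := fun L i j => by
    rw [EuclideanSpace.inner_single_left, ofLp_toEuclideanCLM]
    simp
  rw [maxEntangledState, opTensor_coe, Completion.inner_coe, inner_maxEntangledVec]
  simp only [he, transpose_apply, trace, diag, mul_apply]

lemma norm_maxEntangledState (hd : d ≠ 0) : ‖maxEntangledState d‖ ^ 2 = 1 := by
  have h := inner_maxEntangledState (1 : Matrix (Fin d) (Fin d) ℂ) 1
  rw [transpose_one, map_one, opTensor_one, mul_one, trace_one, Fintype.card_fin,
    inv_mul_cancel₀ (by exact_mod_cast hd), one_apply_eq_self, inner_self_eq_norm_sq_to_K] at h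
  exact Complex.ofReal_injective (by simpa using h)

/-- A realisation of the Bell scenario on the maximally entangled state of `ℂᵈ ⊗ ℂᵈ`. -/
noncomputable def maxEntangled (hd : d ≠ 0)
    (alice : Pairs (d ^ 2) → Measurement (Fin 3) (EuclideanSpace ℂ (Fin d)))
    (bob : Fin (d ^ 2) → Measurement (Fin 2) (EuclideanSpace ℂ (Fin d))) :
    Realisation d (EuclideanSpace ℂ (Fin d)) (EuclideanSpace ℂ (Fin d)) where
  ψ i := if i = 0 then maxEntangledState d else 0
  hasSum_norm_sq := by
    convert hasSum_single (f := fun i : ℕ => ‖(if i = 0 then maxEntangledState d else 0)‖ ^ 2) 0 ?_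
      using 1
    · simp [norm_maxEntangledState hd]
    · intro i hi
      simp [hi]
  alice := alice
  bob := bob

/-- On the maximally entangled state, `Tr (ρ (Mᵀ ⊗ N)) = tr (M N) / d`. -/
lemma maxEntangled_corr (hd : d ≠ 0) (alice : Pairs (d ^ 2) → Measurement (Fin 3) _)
    (bob : Fin (d ^ 2) → Measurement (Fin 2) _) (M N : Matrix (Fin d) (Fin d) ℂ) :
    (maxEntangled hd alice bob).corr (toEuclideanCLM (𝕜 := ℂ) Mᵀ) (toEuclideanCLM (𝕜 := ℂ) N)
      = (d : ℝ)⁻¹ * (M * N).trace.re := by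
  rw [Realisation.corr_apply, Realisation.expect, tsum_eq_single 0]
  · simp only [maxEntangled, if_true]
    rw [inner_maxEntangledState, ← Complex.ofReal_natCast, ← Complex.ofReal_inv, Complex.re_ofReal_mul]
  · intro i hi
    simp [maxEntangled, hi]

lemma maxEntangled_bobFullRank (hd : d ≠ 0) (alice : Pairs (d ^ 2) → Measurement (Fin 3) _)
    (bob : Fin (d ^ 2) → Measurement (Fin 2) _) : (maxEntangled hd alice bob).BobFullRank := by
  intro φ hφ
  have e : InnerProductSpace.rankOne ℂ φ φ = toEuclideanCLM (𝕜 := ℂ) (vecMulVec φ (star φ)) := by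
    apply ContinuousLinearMap.coe_injective
    rw [coe_toEuclideanCLM_eq_toEuclideanLin, ← InnerProductSpace.symm_toEuclideanLin_rankOne,
      LinearEquiv.apply_symm_apply]
  rw [Realisation.bobMarginal, ← Realisation.corr_apply, e,
    ← map_one (toEuclideanCLM (n := Fin d) (𝕜 := ℂ)), ← transpose_one, maxEntangled_corr, one_mul,
    trace_vecMulVec, ← EuclideanSpace.inner_eq_star_dotProduct]
  have h1 : (⟪φ, φ⟫_ℂ).re = ‖φ‖ ^ 2 := inner_self_eq_norm_sq (𝕜 := ℂ) φ
  rw [h1]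
  have := norm_pos_iff.mpr hφ
  positivity

lemma isPositive_toEuclideanCLM {M : Matrix (Fin d) (Fin d) ℂ} (hM : IsStarProjection M) :
    (toEuclideanCLM (𝕜 := ℂ) M).IsPositive :=
  .of_isStarProjection (hM.map _)

lemma isPositive_toEuclideanCLM_transpose {M : Matrix (Fin d) (Fin d) ℂ}
    (hM : IsStarProjection M) : (toEuclideanCLM (𝕜 := ℂ) Mᵀ).IsPositive := by
  refine isPositive_toEuclideanCLM ⟨?_, ?_⟩
  · rw [IsIdempotentElem, ← transpose_mul, hM.isIdempotentElem.eq]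
  · rw [IsSelfAdjoint, star_eq_conjTranspose, conjTranspose, transpose_transpose,
      ← congrArg transpose hM.isSelfAdjoint.star_eq, star_eq_conjTranspose, conjTranspose]
    ext i j
    simp

end MaximallyEntangled

namespace IsSIC

open Matrix

variable {d : ℕ} {r : Fin (d ^ 2) → EuclideanSpace ℂ (Fin d)}

/-- The matrix of the projection onto the `j`-th vector. -/
def proj (r : Fin (d ^ 2) → EuclideanSpace ℂ (Fin d)) (j : Fin (d ^ 2)) :
    Matrix (Fin d) (Fin d) ℂ :=
  vecMulVec (r j) (star (r j))

lemma isStarProjection_proj (hr : IsSIC r) (j : Fin (d ^ 2)) : IsStarProjection (proj r j) := by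
  refine ⟨?_, ?_⟩
  · rw [IsIdempotentElem, proj, vecMulVec_mul_vecMulVec, dotProduct_comm,
      ← EuclideanSpace.inner_eq_star_dotProduct, inner_self_eq_norm_sq_to_K, hr.norm_eq]
    simp
  · rw [IsSelfAdjoint, star_eq_conjTranspose, proj, conjTranspose_vecMulVec, star_star]

lemma trace_proj (hr : IsSIC r) (j : Fin (d ^ 2)) : (proj r j).trace = 1 := by
  rw [proj, trace_vecMulVec, ← EuclideanSpace.inner_eq_star_dotProduct, inner_self_eq_norm_sq_to_K,
    hr.norm_eq]
  simp

lemma inner_mul_inner (hr : IsSIC r) {j k : Fin (d ^ 2)} (h : j ≠ k) :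
    ⟪r j, r k⟫_ℂ * ⟪r k, r j⟫_ℂ = ((1 - gap d ^ 2 : ℝ) : ℂ) := by
  rw [← inner_conj_symm (r k), Complex.mul_conj, Complex.normSq_eq_norm_sq, hr.overlap j k h, gap_sq]
  congr 1
  field_simp
  ring

lemma trace_proj_mul (hr : IsSIC r) {j k : Fin (d ^ 2)} (h : j ≠ k) :
    (proj r j * proj r k).trace = ((1 - gap d ^ 2 : ℝ) : ℂ) := by
  rw [proj, proj, vecMulVec_mul_vecMulVec, trace_vecMulVec, dotProduct_smul, dotProduct_comm,
    ← EuclideanSpace.inner_eq_star_dotProduct, ← EuclideanSpace.inner_eq_star_dotProduct,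
    smul_eq_mul, hr.inner_mul_inner h]

lemma proj_mul_proj_mul (hr : IsSIC r) {j k : Fin (d ^ 2)} (h : j ≠ k) :
    proj r j * proj r k * proj r j = (1 - gap d ^ 2) • proj r j := by
  rw [proj, proj, vecMulVec_mul_vecMulVec, vecMulVec_mul_vecMulVec, smul_dotProduct,
    dotProduct_comm, dotProduct_comm (star (r k).ofLp),
    ← EuclideanSpace.inner_eq_star_dotProduct, ← EuclideanSpace.inner_eq_star_dotProduct,
    smul_eq_mul, hr.inner_mul_inner h, ← Complex.coe_smul, vecMulVec_smul]

/-- The difference of the projections onto two vectors. -/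
def projDiff (r : Fin (d ^ 2) → EuclideanSpace ℂ (Fin d)) (x : Pairs (d ^ 2)) :
    Matrix (Fin d) (Fin d) ℂ :=
  proj r x.1.1 - proj r x.1.2

lemma isSelfAdjoint_projDiff (hr : IsSIC r) (x : Pairs (d ^ 2)) :
    IsSelfAdjoint (projDiff r x) :=
  (hr.isStarProjection_proj _).isSelfAdjoint.sub (hr.isStarProjection_proj _).isSelfAdjoint

lemma projDiff_cubed (hr : IsSIC r) (x : Pairs (d ^ 2)) :
    projDiff r x * projDiff r x * projDiff r x = gap d ^ 2 • projDiff r x :=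
  diff_cubed_of_sandwich (hr.isStarProjection_proj _).isIdempotentElem.eq
    (hr.isStarProjection_proj _).isIdempotentElem.eq (hr.proj_mul_proj_mul x.2.ne)
    (hr.proj_mul_proj_mul x.2.ne')

lemma trace_projDiff_mul_self (hr : IsSIC r) (x : Pairs (d ^ 2)) :
    (projDiff r x * projDiff r x).trace = ((2 * gap d ^ 2 : ℝ) : ℂ) := by
  rw [projDiff, sub_mul, mul_sub, mul_sub, (hr.isStarProjection_proj _).isIdempotentElem.eq,
    (hr.isStarProjection_proj _).isIdempotentElem.eq, trace_sub, trace_sub, trace_sub,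
    hr.trace_proj, hr.trace_proj, hr.trace_proj_mul x.2.ne, hr.trace_proj_mul x.2.ne']
  push_cast
  ring

lemma trace_projDiff (hr : IsSIC r) (x : Pairs (d ^ 2)) : (projDiff r x).trace = 0 := by
  rw [projDiff, trace_sub, hr.trace_proj, hr.trace_proj, sub_self]

/-- The projection onto the eigenspace of `projDiff r x` for the eigenvalue `g`, where
`g = gap d` or `g = -gap d`. -/
noncomputable def eigenproj (r : Fin (d ^ 2) → EuclideanSpace ℂ (Fin d)) (g : ℝ)
    (x : Pairs (d ^ 2)) : Matrix (Fin d) (Fin d) ℂ :=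
  (2 * g ^ 2)⁻¹ • (projDiff r x * projDiff r x + g • projDiff r x)

/-- Alice's measurement is the transpose of the spectral measurement of `projDiff r x`, with
outcomes for the eigenvalues `gap d`, `-gap d` and `0`. -/
noncomputable def alice (hd : d ≠ 0) (hr : IsSIC r) (x : Pairs (d ^ 2)) :
    Measurement (Fin 3) (EuclideanSpace ℂ (Fin d)) where
  effect := ![toEuclideanCLM (𝕜 := ℂ) (eigenproj r (gap d) x)ᵀ,
    toEuclideanCLM (𝕜 := ℂ) (eigenproj r (-gap d) x)ᵀ,
    toEuclideanCLM (𝕜 := ℂ) (1 - (gap d ^ 2)⁻¹ • (projDiff r x * projDiff r x))ᵀ]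
  isPositive i := by
    have hg := (gap_pos hd).ne'
    have h := hr.projDiff_cubed x
    fin_cases i
    · exact isPositive_toEuclideanCLM_transpose
        (isStarProjection_spectral hg (hr.isSelfAdjoint_projDiff x) h)
    · exact isPositive_toEuclideanCLM_transpose
        (isStarProjection_spectral (neg_ne_zero.mpr hg) (hr.isSelfAdjoint_projDiff x)
          (by rw [neg_sq]; exact h))
    · exact isPositive_toEuclideanCLM_transpose
        (isStarProjection_kernel hg (hr.isSelfAdjoint_projDiff x) h)
  sum_effect := by
    have hg := (gap_pos hd).ne'
    rw [Fin.sum_univ_three]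
    simp only [cons_val]
    rw [← map_add, ← map_add, ← transpose_add, ← transpose_add, eigenproj, eigenproj]
    rw [show (2 * gap d ^ 2)⁻¹ • (projDiff r x * projDiff r x + gap d • projDiff r x) +
      (2 * (-gap d) ^ 2)⁻¹ • (projDiff r x * projDiff r x + (-gap d) • projDiff r x) +
      (1 - (gap d ^ 2)⁻¹ • (projDiff r x * projDiff r x)) = 1 by
        rw [neg_sq]; match_scalars <;> field_simp <;> ring]
    rw [transpose_one, map_one]

/-- Bob measures the projections of the SIC. -/
noncomputable def bob (hr : IsSIC r) (y : Fin (d ^ 2)) :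
    Measurement (Fin 2) (EuclideanSpace ℂ (Fin d)) where
  effect := ![toEuclideanCLM (𝕜 := ℂ) (proj r y), toEuclideanCLM (𝕜 := ℂ) (1 - proj r y)]
  isPositive i := by
    fin_cases i
    · exact isPositive_toEuclideanCLM (hr.isStarProjection_proj y)
    · exact isPositive_toEuclideanCLM (hr.isStarProjection_proj y).one_sub
  sum_effect := by
    rw [Fin.sum_univ_two]
    simp only [cons_val_zero, cons_val_one]
    rw [← map_add, add_sub_cancel, map_one]

theorem scoreS_maxEntangled (hd : d ≠ 0) (hr : IsSIC r) :
    (maxEntangled hd (hr.alice hd) hr.bob).scoreS = quantumValue d := by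
  have hg := gap_pos hd
  set R := maxEntangled hd (hr.alice hd) hr.bob
  have hdiff : ∀ x, R.diff x = toEuclideanCLM (𝕜 := ℂ) (projDiff r x) := fun x =>
    (map_sub _ _ _).symm
  have hB : ∀ y, R.B y = toEuclideanCLM (𝕜 := ℂ) (proj r y) := fun y => rfl
  have h0 : ∀ x, (R.alice x).effect 0 = toEuclideanCLM (𝕜 := ℂ) (eigenproj r (gap d) x)ᵀ :=
    fun x => rfl
  have h1 : ∀ x, (R.alice x).effect 1 = toEuclideanCLM (𝕜 := ℂ) (eigenproj r (-gap d) x)ᵀ :=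
    fun x => rfl
  have hone : (1 : EuclideanSpace ℂ (Fin d) →L[ℂ] EuclideanSpace ℂ (Fin d))
      = toEuclideanCLM (𝕜 := ℂ) (1 : Matrix (Fin d) (Fin d) ℂ) := (map_one _).symm
  have hD : ∀ g, g ^ 2 = gap d ^ 2 → ∀ x,
      R.corr (toEuclideanCLM (𝕜 := ℂ) (eigenproj r g x)ᵀ) (R.diff x) = (d : ℝ)⁻¹ * g :=
    fun g hgg x => by
      rw [hdiff, maxEntangled_corr, eigenproj, smul_mul_assoc, add_mul, hr.projDiff_cubed,
        smul_mul_assoc, trace_smul, trace_add, trace_smul, trace_smul, hr.trace_projDiff,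
        hr.trace_projDiff_mul_self, smul_zero, zero_add, Complex.smul_re, Complex.smul_re,
        Complex.ofReal_re, smul_eq_mul, smul_eq_mul, hgg]
      field_simp
  have hA : ∀ g, g ^ 2 = gap d ^ 2 → ∀ x,
      R.corr (toEuclideanCLM (𝕜 := ℂ) (eigenproj r g x)ᵀ) 1 = (d : ℝ)⁻¹ := fun g hgg x => by
    rw [hone, maxEntangled_corr, eigenproj, mul_one, trace_smul, trace_add, trace_smul,
      hr.trace_projDiff, hr.trace_projDiff_mul_self, smul_zero, add_zero, Complex.smul_re,
      Complex.ofReal_re, smul_eq_mul, hgg]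
    field_simp
  have hb : ∀ y, R.corr 1 (R.B y) = (d : ℝ)⁻¹ := fun y => by
    rw [hB, hone, ← transpose_one, maxEntangled_corr, one_mul, hr.trace_proj, Complex.one_re,
      mul_one]
  have hN := two_mul_card_pairs (d ^ 2)
  have hsq : gap d ^ 2 * (d + 1) = d := by rw [gap_sq]; field_simp
  have hs : shortfall d * 2 = shortfall d * d := by
    unfold shortfall
    split_ifs with h <;> simp [h]
  have hd' : (d : ℝ) ≠ 0 := by exact_mod_cast hd
  simp only [Realisation.scoreS_eq, h0, h1, hD _ rfl, hA _ rfl, hD _ (neg_sq _), hA _ (neg_sq _),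
    hb, Finset.sum_const, Finset.card_univ,
    nsmul_eq_mul, Fintype.card_fin, quantumValue_eq hd, α_eq, β_eq hd]
  push_cast at hN ⊢
  field_simp
  linear_combination gap d ^ 2 * hN + d ^ 2 * (d - 1) * hsq +
    2 * gap d * Fintype.card (Pairs (d ^ 2)) * hs

end IsSIC

end SICBell

theorem theorem5 (d : ℕ) (hd : 2 ≤ d) :
    -- `quantumValue d` bounds the Bell functional over all quantum realisations,
    (∀ (HA : Type u) (HB : Type v) [NormedAddCommGroup HA] [InnerProductSpace ℂ HA]
        [CompleteSpace HA] [NormedAddCommGroup HB] [InnerProductSpace ℂ HB] [CompleteSpace HB]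
        (R : SICBell.Realisation d HA HB), R.scoreS ≤ SICBell.quantumValue d) ∧
    -- and it is attained if a SIC exists in dimension `d`.
    ((∃ r : Fin (d ^ 2) → EuclideanSpace ℂ (Fin d), SICBell.IsSIC r) →
      ∃ R : SICBell.Realisation d (EuclideanSpace ℂ (Fin d)) (EuclideanSpace ℂ (Fin d)),
        R.BobFullRank ∧ R.scoreS = SICBell.quantumValue d) ∧
    -- If it is attained and Bob's marginal state has full rank, Bob's operators are certified.
    (∀ (HA : Type u) (HB : Type v) [NormedAddCommGroup HA] [InnerProductSpace ℂ HA]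
        [CompleteSpace HA] [NormedAddCommGroup HB] [InnerProductSpace ℂ HB] [CompleteSpace HB]
        (R : SICBell.Realisation d HA HB), R.scoreS = SICBell.quantumValue d → R.BobFullRank →
        SICBell.SICRelations d R.B ∧ SICBell.IsOperationalSIC d R.B) ∧
    -- The certified relations are equivalent to being an operational SIC.
    (∀ (H : Type v) [NormedAddCommGroup H] [InnerProductSpace ℂ H] [CompleteSpace H]
        (B : Fin (d ^ 2) → H →L[ℂ] H),
        SICBell.SICRelations d B ↔ SICBell.IsOperationalSIC d B) := by
  have hd0 : d ≠ 0 := by omega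
  refine ⟨fun HA HB _ _ _ _ _ _ R => R.scoreS_le hd0, ?_, fun HA HB _ _ _ _ _ _ R h hR => ?_,
    fun H _ _ _ B => SICBell.sicRelations_iff_isOperationalSIC B⟩
  · rintro ⟨r, hr⟩
    exact ⟨_, SICBell.maxEntangled_bobFullRank hd0 _ _, hr.scoreS_maxEntangled hd0⟩
  · have hrel := R.sicRelations_B hd0 hR h
    exact ⟨hrel, (SICBell.sicRelations_iff_isOperationalSIC _).mp hrel⟩
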